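/- Let $(M,g,J)$ be a locally conformal Kähler manifold: $(M,g,J)$ is a Hermitian manifold whose Kähler form $\Omega(X,Y)=g(X,JY)$ satisfies $d\Omega=\omega\wedge\Omega$ for a closed $1$-form $\omega$ (the Lee form). Let $B_1=\omega^\sharp$ be the Lee vector field, $g(X,B_1)=\omega(X)$. Let $\pi:M\to B$ be a Lagrangian Riemannian submersion onto a Riemannian manifold $(B,g_B)$, that is, a Riemannian submersion with $J(\ker\pi_*)=(\ker\pi_*)^\perp$, and assume that $B_1$ is vertical, i.e. $B_1\in\Gamma(\ker\pi_*)$. Let $\mathcal V,\mathcal H$ be the orthogonal projections of $TM$ onto $\ker\pi_*$ and $(\ker\pi_*)^\perp$, let $\nabla$ be the Levi-Civita connection of $g$ and $\nabla^\pi$ the pullback along $\pi$ of the Levi-Civita connection of $g_B$, and put $$\mathcal A_EF=\mathcal H\nabla_{\mathcal HE}\mathcal VF+\mathcal V\nabla_{\mathcal HE}\mathcal HF,\qquad (\nabla\pi_*)(E,F)=\nabla^\pi_E(\pi_*F)-\pi_*(\nabla_EF).$$ For horizontal $X$ let $BX=\mathcal V(JX)$ (which here equals $JX$; the letter $B$ in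 $BX$, $BY$ is unrelated to the base manifold). Then the following are equivalent: (a) $(\ker\pi_*)^\perp$ is integrable, i.e. $[X,Y]\in\Gamma((\ker\pi_*)^\perp)$ for all $X,Y\in\Gamma((\ker\pi_*)^\perp)$; (b) $(\nabla\pi_*)(X,JY)=(\nabla\pi_*)(Y,JX)-\tfrac12 g(BY,B_1)\,\pi_*X+\tfrac12 g(BX,B_1)\,\pi_*Y$ for all $X,Y\in\Gamma((\ker\pi_*)^\perp)$; (c) $\pi_*(\mathcal A_XJY-\mathcal A_YJX)=\tfrac12 g(BY,B_1)\,\pi_*X-\tfrac12 g(BX,B_1)\,\pi_*Y$ for all $X,Y\in\Gamma((\ker\pi_*)^\perp)$. -/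

import Mathlib

open Bundle Manifold VectorField
open scoped ContDiff

instance tangentSpace_finiteDimensional {E : Type*} [NormedAddCommGroup E] [NormedSpace ℝ E]
    [FiniteDimensional ℝ E] {H : Type*} [TopologicalSpace H] (I : ModelWithCorners ℝ E H)
    {M : Type*} [TopologicalSpace M] [ChartedSpace H M] (x : M) :
    FiniteDimensional ℝ (TangentSpace I x) :=
  inferInstanceAs (FiniteDimensional ℝ E)

section LeviCivita

set_option linter.unusedSectionVars false

variable {E : Type*} [NormedAddCommGroup E] [NormedSpace ℝ E] [FiniteDimensional ℝ E]
  {H : Type*} [TopologicalSpace H] (I : ModelWithCorners ℝ E H)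
  {M : Type*} [TopologicalSpace M] [ChartedSpace H M] [IsManifold I ∞ M]
  [RiemannianBundle (fun x : M ↦ TangentSpace I x)]

/-- The right-hand side of the Koszul formula for `2 ⟨∇_X Y, Z⟩` at `x`. -/
noncomputable def koszulForm (X Y Z : Π x : M, TangentSpace I x) (x : M) : ℝ :=
  mvfderiv I (fun y ↦ inner ℝ (Y y) (Z y)) x (X x)
    + mvfderiv I (fun y ↦ inner ℝ (X y) (Z y)) x (Y x)
    - mvfderiv I (fun y ↦ inner ℝ (X y) (Y y)) x (Z x)
    + inner ℝ (mlieBracket I X Y x) (Z x)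
    - inner ℝ (mlieBracket I Y Z x) (X x)
    - inner ℝ (mlieBracket I X Z x) (Y x)

variable [IsContMDiffRiemannianBundle I ∞ E (fun x : M ↦ TangentSpace I x)]
variable {I}
variable {x : M} {X Y Z : Π x : M, TangentSpace I x}

lemma mdiffAt_inner_tangent (hX : MDiffAt (T% X) x) (hY : MDiffAt (T% Y) x) :
    MDiffAt (fun y ↦ inner ℝ (X y) (Y y)) x :=
  MDifferentiableAt.inner_bundle (E := fun x : M ↦ TangentSpace I x) hX hY

lemma koszulForm_tensorial_left (hY : MDiffAt (T% Y) x) (hZ : MDiffAt (T% Z) x) :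
    TensorialAt I E (fun X : Π x : M, TangentSpace I x ↦ koszulForm I X Y Z x) x where
  smul {f X} hf hX := by
    have h1 := mdiffAt_inner_tangent hX hZ
    have h2 := mdiffAt_inner_tangent hX hY
    simp [koszulForm, inner_smul_left, mvfderiv_fun_mul hf h1, mvfderiv_fun_mul hf h2,
      mlieBracket_smul_left hf hX, inner_add_left, inner_smul_right]
    ring
  add {X X'} hX hX' := by
    simp [koszulForm, inner_add_left, inner_add_right,
      mvfderiv_fun_add (mdiffAt_inner_tangent hX hZ) (mdiffAt_inner_tangent hX' hZ),
      mvfderiv_fun_add (mdiffAt_inner_tangent hX hY) (mdiffAt_inner_tangent hX' hY),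
      mlieBracket_add_left hX hX']
    ring

lemma koszulForm_tensorial_right (hX : MDiffAt (T% X) x) (hY : MDiffAt (T% Y) x) :
    TensorialAt I E (fun Z : Π x : M, TangentSpace I x ↦ koszulForm I X Y Z x) x where
  smul {f Z} hf hZ := by
    have h1 := mdiffAt_inner_tangent hX hZ
    have h2 := mdiffAt_inner_tangent hY hZ
    simp [koszulForm, inner_smul_left, mvfderiv_fun_mul hf h1, mvfderiv_fun_mul hf h2,
      mlieBracket_smul_right hf hZ, inner_add_left, inner_smul_right]
    rw [real_inner_comm (X x) (Z x), real_inner_comm (Y x) (Z x)]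
    ring
  add {Z Z'} hZ hZ' := by
    simp [koszulForm, inner_add_left, inner_add_right,
      mvfderiv_fun_add (mdiffAt_inner_tangent hX hZ) (mdiffAt_inner_tangent hX hZ'),
      mvfderiv_fun_add (mdiffAt_inner_tangent hY hZ) (mdiffAt_inner_tangent hY hZ'),
      mlieBracket_add_right hZ hZ']
    ring

open scoped Classical in
/-- `(X, Z) ↦ 2 ⟨∇_X Y, Z⟩` as a bilinear form on the tangent space at `x`
(zero if `Y` is not differentiable at `x`). -/
noncomputable def koszulHom (I : ModelWithCorners ℝ E H) {M : Type*} [TopologicalSpace M]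
    [ChartedSpace H M] [IsManifold I ∞ M] [RiemannianBundle (fun x : M ↦ TangentSpace I x)]
    [IsContMDiffRiemannianBundle I ∞ E (fun x : M ↦ TangentSpace I x)]
    (Y : Π x : M, TangentSpace I x) (x : M) :
    TangentSpace I x →L[ℝ] TangentSpace I x →L[ℝ] ℝ :=
  if hY : MDiffAt (T% Y) x then
    TensorialAt.mkHom₂ (fun X Z : Π x : M, TangentSpace I x ↦ koszulForm I X Y Z x) x
      (fun _ hZ ↦ koszulForm_tensorial_left hY hZ) (fun _ hX ↦ koszulForm_tensorial_right hX hY)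
  else 0

lemma koszulHom_apply (hX : MDiffAt (T% X) x) (hY : MDiffAt (T% Y) x) (hZ : MDiffAt (T% Z) x) :
    koszulHom I Y x (X x) (Z x) = koszulForm I X Y Z x := by
  rw [koszulHom, dif_pos hY]
  exact TensorialAt.mkHom₂_apply _ _ hX hZ

/-- The map underlying the Levi-Civita connection: `∇_X Y` at `x` is the vector that represents
half of the Koszul form. -/
noncomputable def leviCivitaFun (I : ModelWithCorners ℝ E H) {M : Type*} [TopologicalSpace M]
    [ChartedSpace H M] [IsManifold I ∞ M] [RiemannianBundle (fun x : M ↦ TangentSpace I x)]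
    [IsContMDiffRiemannianBundle I ∞ E (fun x : M ↦ TangentSpace I x)]
    (Y : Π x : M, TangentSpace I x) (x : M) :
    TangentSpace I x →L[ℝ] TangentSpace I x :=
  (2⁻¹ : ℝ) • LinearMap.toContinuousLinearMap
    ((InnerProductSpace.toDual ℝ (TangentSpace I x)).symm.toLinearEquiv.toLinearMap ∘ₗ
      (koszulHom I Y x).toLinearMap)

lemma inner_leviCivitaFun (hX : MDiffAt (T% X) x) (hY : MDiffAt (T% Y) x)
    (hZ : MDiffAt (T% Z) x) :
    inner ℝ (leviCivitaFun I Y x (X x)) (Z x) = 2⁻¹ * koszulForm I X Y Z x := by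
  rw [← koszulHom_apply hX hY hZ]
  simp [leviCivitaFun, inner_smul_left]

/-- To compare two endomorphisms of a tangent space it suffices to evaluate on
differentiable vector fields. -/
lemma eq_of_inner_vectorField {A B : TangentSpace I x →L[ℝ] TangentSpace I x}
    (h : ∀ X Z : Π x : M, TangentSpace I x, MDiffAt (T% X) x → MDiffAt (T% Z) x →
      inner ℝ (A (X x)) (Z x) = inner ℝ (B (X x)) (Z x)) : A = B := by
  ext v
  refine ext_inner_right ℝ fun w ↦ ?_
  simpa using h (FiberBundle.extend E v) (FiberBundle.extend E w)
    (FiberBundle.mdifferentiableAt_extend I E v) (FiberBundle.mdifferentiableAt_extend I E w)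

lemma leviCivitaFun_add (hX : MDiffAt (T% X) x) (hY : MDiffAt (T% Y) x) :
    leviCivitaFun I (X + Y) x = leviCivitaFun I X x + leviCivitaFun I Y x := by
  refine eq_of_inner_vectorField fun W Z hW hZ ↦ ?_
  have hXY : MDiffAt (T% (X + Y)) x := mdifferentiableAt_add_section hX hY
  rw [inner_leviCivitaFun hW hXY hZ, add_apply, inner_add_left,
    inner_leviCivitaFun hW hX hZ, inner_leviCivitaFun hW hY hZ]
  simp [koszulForm, inner_add_left, inner_add_right,
    mvfderiv_fun_add (mdiffAt_inner_tangent hX hZ) (mdiffAt_inner_tangent hY hZ),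
    mvfderiv_fun_add (mdiffAt_inner_tangent hW hX) (mdiffAt_inner_tangent hW hY),
    mlieBracket_add_left hX hY, mlieBracket_add_right hX hY]
  ring

lemma leviCivitaFun_leibniz {f : M → ℝ} (hY : MDiffAt (T% Y) x) (hf : MDiffAt f x) :
    leviCivitaFun I (f • Y) x =
      f x • leviCivitaFun I Y x + (mvfderiv I f x).smulRight (Y x) := by
  refine eq_of_inner_vectorField fun X Z hX hZ ↦ ?_
  have hfY : MDiffAt (T% (f • Y)) x := hf.smul_section hY
  rw [inner_leviCivitaFun hX hfY hZ, add_apply, inner_add_left,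
    smul_apply, inner_smul_left, inner_leviCivitaFun hX hY hZ]
  simp [koszulForm, inner_add_left, inner_smul_left, inner_smul_right,
    mvfderiv_fun_mul hf (mdiffAt_inner_tangent hY hZ),
    mvfderiv_fun_mul hf (mdiffAt_inner_tangent hX hY),
    mlieBracket_smul_left hf hY, mlieBracket_smul_right hf hY]
  rw [real_inner_comm (X x) (Y x)]
  ring

/-- The Levi-Civita connection of a Riemannian manifold, given by the Koszul formula. -/
noncomputable def leviCivita (I : ModelWithCorners ℝ E H) (M : Type*) [TopologicalSpace M]
    [ChartedSpace H M] [IsManifold I ∞ M] [RiemannianBundle (fun x : M ↦ TangentSpace I x)]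
    [IsContMDiffRiemannianBundle I ∞ E (fun x : M ↦ TangentSpace I x)] :
    CovariantDerivative I E (TangentSpace I : M → Type _) where
  toFun := leviCivitaFun I
  isCovariantDerivativeOnUniv :=
    { add := fun hX hY _ ↦ leviCivitaFun_add hX hY
      leibniz := fun hY hf _ ↦ leviCivitaFun_leibniz hY hf }

/-- The Levi-Civita connection is torsion-free. -/
theorem leviCivita_torsion : (leviCivita I M).torsion = 0 := by
  rw [CovariantDerivative.torsion_eq_zero_iff]
  intro X Y x hX hY
  refine ext_inner_right ℝ fun w ↦ ?_
  have hW := FiberBundle.mdifferentiableAt_extend I E w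
  have h1 := inner_leviCivitaFun hX hY hW
  have h2 := inner_leviCivitaFun hY hX hW
  simp only [FiberBundle.extend_apply_self] at h1 h2
  change inner ℝ (leviCivitaFun I Y x (X x) - leviCivitaFun I X x (Y x)) w = _
  rw [inner_sub_left, h1, h2]
  simp only [koszulForm, FiberBundle.extend_apply_self]
  rw [mlieBracket_swap_apply (V := Y) (W := X), inner_neg_left]
  simp only [real_inner_comm]
  ring

/-- The Levi-Civita connection is compatible with the metric. -/
theorem leviCivita_metric (hY : MDiffAt (T% Y) x) (hZ : MDiffAt (T% Z) x)
    (v : TangentSpace I x) :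
    mvfderiv I (fun y ↦ inner ℝ (Y y) (Z y)) x v =
      inner ℝ (leviCivita I M Y x v) (Z x) + inner ℝ (Y x) (leviCivita I M Z x v) := by
  have hV := FiberBundle.mdifferentiableAt_extend I E v
  have h1 := inner_leviCivitaFun hV hY hZ
  have h2 := inner_leviCivitaFun hV hZ hY
  simp only [FiberBundle.extend_apply_self] at h1 h2
  change _ = inner ℝ (leviCivitaFun I Y x v) (Z x) + inner ℝ (Y x) (leviCivitaFun I Z x v)
  rw [real_inner_comm (leviCivitaFun I Z x v), h1, h2]
  simp only [koszulForm, FiberBundle.extend_apply_self]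
  rw [mlieBracket_swap_apply (V := Z) (W := Y), inner_neg_left]
  simp only [real_inner_comm]
  ring

end LeviCivita

section PullbackConnection

variable {E : Type*} [NormedAddCommGroup E] [NormedSpace ℝ E]
  {H : Type*} [TopologicalSpace H] (I : ModelWithCorners ℝ E H)
  {M : Type*} [TopologicalSpace M] [ChartedSpace H M]
  {E' : Type*} [NormedAddCommGroup E'] [NormedSpace ℝ E'] [FiniteDimensional ℝ E']
  {H' : Type*} [TopologicalSpace H'] {I' : ModelWithCorners ℝ E' H'}
  {B : Type*} [TopologicalSpace B] [ChartedSpace H' B] [IsManifold I' ∞ B]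

/-- The pullback along `f : M → B` of a connection `cov` on `TB`: for a section `s` of `f⁻¹(TB)`,
write `s = ∑ sⁱ • (eᵢ ∘ f)` near `p` in the frame `eᵢ` given by the preferred trivialization of `TB`
at `f p`; then `∇^f_v s = ∑ dsⁱ(v) • eᵢ(f p) + ∑ sⁱ(p) • cov_{f_* v} eᵢ`. The second sum is `cov`
applied to the field `FiberBundle.extend E' (s p)`, whose components in this frame are the
constants `sⁱ(p)`. -/
noncomputable def pullbackConnection
    (cov : CovariantDerivative I' E' (TangentSpace I' : B → Type _)) (f : M → B)
    (s : Π x : M, TangentSpace I' (f x)) (p : M) :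
    TangentSpace I p →L[ℝ] TangentSpace I' (f p) :=
  (trivializationAt E' (TangentSpace I' : B → Type _) (f p)).symmL ℝ (f p) ∘L
      mvfderiv I
        (fun x ↦ (trivializationAt E' (TangentSpace I' : B → Type _) (f p) ⟨f x, s x⟩).2) p
    + cov (FiberBundle.extend E' (s p)) (f p) ∘L mfderiv I I' f p

end PullbackConnection

section Submersion

variable {E : Type*} [NormedAddCommGroup E] [NormedSpace ℝ E] [FiniteDimensional ℝ E]
  {H : Type*} [TopologicalSpace H] (I : ModelWithCorners ℝ E H)
  {M : Type*} [TopologicalSpace M] [ChartedSpace H M] [IsManifold I ∞ M]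
  [RiemannianBundle (fun x : M ↦ TangentSpace I x)]
  {E' : Type*} [NormedAddCommGroup E'] [NormedSpace ℝ E'] [FiniteDimensional ℝ E']
  {H' : Type*} [TopologicalSpace H'] (I' : ModelWithCorners ℝ E' H')
  {B : Type*} [TopologicalSpace B] [ChartedSpace H' B] [IsManifold I' ∞ B]
  [RiemannianBundle (fun y : B ↦ TangentSpace I' y)]

/-- The vertical space `ker f_*` at `x`. -/
noncomputable def verticalSpace (f : M → B) (x : M) : Submodule ℝ (TangentSpace I x) :=
  LinearMap.ker (mfderiv I I' f x).toLinearMap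

/-- The horizontal space `(ker f_*)^⊥` at `x`. -/
noncomputable def horizontalSpace (f : M → B) (x : M) : Submodule ℝ (TangentSpace I x) :=
  (verticalSpace I I' f x)ᗮ

/-- The orthogonal projection `𝒱` onto the vertical space. -/
noncomputable def vert (f : M → B) (x : M) (v : TangentSpace I x) : TangentSpace I x :=
  (verticalSpace I I' f x).starProjection v

/-- The orthogonal projection `ℋ` onto the horizontal space. -/
noncomputable def horiz (f : M → B) (x : M) (v : TangentSpace I x) : TangentSpace I x :=
  (horizontalSpace I I' f x).starProjection v

/-- A smooth map of `M` onto `B` of maximal rank whose differential preserves the lengths of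
horizontal vectors. -/
structure IsRiemannianSubmersion (f : M → B) : Prop where
  contMDiff : ContMDiff I I' ∞ f
  surjective : Function.Surjective f
  surjective_mfderiv : ∀ x, Function.Surjective (mfderiv I I' f x)
  norm_mfderiv : ∀ x, ∀ v ∈ horizontalSpace I I' f x, ‖mfderiv I I' f x v‖ = ‖v‖

/-- `X ∈ Γ((ker f_*)^⊥)`: a smooth vector field on `M` that is horizontal everywhere. -/
structure IsHorizontalField (f : M → B) (X : Π x : M, TangentSpace I x) : Prop where
  contMDiff : ContMDiff I (I.prod 𝓘(ℝ, E)) ∞ (fun x ↦ (⟨x, X x⟩ : TangentBundle I M))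
  horizontal : ∀ x, X x ∈ horizontalSpace I I' f x

/-- The horizontal distribution `(ker f_*)^⊥` is integrable: it is closed under Lie brackets. -/
def IsHorizontalIntegrable (f : M → B) : Prop :=
  ∀ X Y : Π x : M, TangentSpace I x, IsHorizontalField I I' f X → IsHorizontalField I I' f Y →
    ∀ x, mlieBracket I X Y x ∈ horizontalSpace I I' f x

variable [IsContMDiffRiemannianBundle I ∞ E (fun x : M ↦ TangentSpace I x)]

/-- O'Neill's tensor `𝒜_X Y = ℋ ∇_{ℋX} (𝒱Y) + 𝒱 ∇_{ℋX} (ℋY)`. -/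
noncomputable def oneillA (f : M → B) (X Y : Π x : M, TangentSpace I x) (x : M) :
    TangentSpace I x :=
  horiz I I' f x
      (leviCivita I M (fun y ↦ vert I I' f y (Y y)) x (horiz I I' f x (X x)))
    + vert I I' f x
      (leviCivita I M (fun y ↦ horiz I I' f y (Y y)) x (horiz I I' f x (X x)))

variable [IsContMDiffRiemannianBundle I' ∞ E' (fun y : B ↦ TangentSpace I' y)]

/-- The second fundamental form `(∇f_*)(X, Y) = ∇^f_X (f_* Y) - f_* (∇_X Y)`. -/
noncomputable def secondFundamentalForm (f : M → B) (X Y : Π x : M, TangentSpace I x) (x : M) :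
    TangentSpace I' (f x) :=
  pullbackConnection I (leviCivita I' B) f (fun y ↦ mfderiv I I' f y (Y y)) x (X x)
    - mfderiv I I' f x (leviCivita I M Y x (X x))

end Submersion

section LCK

variable {E : Type*} [NormedAddCommGroup E] [NormedSpace ℝ E] [FiniteDimensional ℝ E]
  {H : Type*} [TopologicalSpace H] (I : ModelWithCorners ℝ E H)
  {M : Type*} [TopologicalSpace M] [ChartedSpace H M] [IsManifold I ∞ M]

/-- The exterior derivative of a `1`-form, evaluated on vector fields:
`dη(X, Y) = X η(Y) - Y η(X) - η([X, Y])`. -/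
noncomputable def extDerivOneForm (η : Π x : M, TangentSpace I x →L[ℝ] ℝ)
    (X Y : Π x : M, TangentSpace I x) (x : M) : ℝ :=
  mvfderiv I (fun y ↦ η y (Y y)) x (X x) - mvfderiv I (fun y ↦ η y (X y)) x (Y x)
    - η x (mlieBracket I X Y x)

/-- The exterior derivative of a `2`-form, evaluated on vector fields:
`dΩ(X, Y, Z) = X Ω(Y, Z) - Y Ω(X, Z) + Z Ω(X, Y) - Ω([X, Y], Z) + Ω([X, Z], Y) - Ω([Y, Z], X)`. -/
noncomputable def extDerivTwoForm (Ω : Π x : M, TangentSpace I x → TangentSpace I x → ℝ)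
    (X Y Z : Π x : M, TangentSpace I x) (x : M) : ℝ :=
  mvfderiv I (fun y ↦ Ω y (Y y) (Z y)) x (X x) - mvfderiv I (fun y ↦ Ω y (X y) (Z y)) x (Y x)
    + mvfderiv I (fun y ↦ Ω y (X y) (Y y)) x (Z x)
    - Ω x (mlieBracket I X Y x) (Z x) + Ω x (mlieBracket I X Z x) (Y x)
    - Ω x (mlieBracket I Y Z x) (X x)

/-- The Nijenhuis tensor `[JX, JY] - J[JX, Y] - J[X, JY] - [X, Y]` of `J` (with `J² = -1`). -/
noncomputable def nijenhuis (J : Π x : M, TangentSpace I x →L[ℝ] TangentSpace I x)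
    (X Y : Π x : M, TangentSpace I x) (x : M) : TangentSpace I x :=
  mlieBracket I (fun y ↦ J y (X y)) (fun y ↦ J y (Y y)) x
    - J x (mlieBracket I (fun y ↦ J y (X y)) Y x)
    - J x (mlieBracket I X (fun y ↦ J y (Y y)) x)
    - mlieBracket I X Y x

variable [RiemannianBundle (fun x : M ↦ TangentSpace I x)]

/-- The Kähler form `Ω(X, Y) = g(X, JY)`. -/
noncomputable def kaehlerForm (J : Π x : M, TangentSpace I x →L[ℝ] TangentSpace I x) (x : M)
    (v w : TangentSpace I x) : ℝ :=
  inner ℝ v (J x w)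

/-- `(M, g, J)` is a Hermitian manifold: `J` is a smooth almost complex structure which is
compatible with the metric and integrable (its Nijenhuis tensor vanishes). -/
structure IsHermitianStructure (J : Π x : M, TangentSpace I x →L[ℝ] TangentSpace I x) :
    Prop where
  contMDiff : ContMDiff I (I.prod 𝓘(ℝ, E →L[ℝ] E)) ∞
    (fun x ↦ TotalSpace.mk' (E →L[ℝ] E) (E := fun x ↦ TangentSpace I x →L[ℝ] TangentSpace I x)
      x (J x))
  sq : ∀ x v, J x (J x v) = -v
  inner_map_map : ∀ x (v w : TangentSpace I x), inner ℝ (J x v) (J x w) = inner ℝ v w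
  nijenhuis_eq_zero : ∀ (x : M) (X Y : Π x : M, TangentSpace I x), MDiffAt (T% X) x →
    MDiffAt (T% Y) x → nijenhuis I J X Y x = 0

/-- `η` is a Lee form for `(g, J)`: a smooth closed `1`-form with `dΩ = η ∧ Ω`. -/
structure IsLeeForm (J : Π x : M, TangentSpace I x →L[ℝ] TangentSpace I x)
    (η : Π x : M, TangentSpace I x →L[ℝ] ℝ) : Prop where
  contMDiff : ContMDiff I (I.prod 𝓘(ℝ, E →L[ℝ] ℝ)) ∞
    (fun x ↦ TotalSpace.mk' (E →L[ℝ] ℝ) (E := fun x ↦ TangentSpace I x →L[ℝ] ℝ) x (η x))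
  closed : ∀ (x : M) (X Y : Π x : M, TangentSpace I x), MDiffAt (T% X) x → MDiffAt (T% Y) x →
    extDerivOneForm I η X Y x = 0
  extDeriv_kaehlerForm : ∀ (x : M) (X Y Z : Π x : M, TangentSpace I x), MDiffAt (T% X) x →
    MDiffAt (T% Y) x → MDiffAt (T% Z) x →
    extDerivTwoForm I (kaehlerForm I J) X Y Z x =
      η x (X x) * kaehlerForm I J x (Y x) (Z x) - η x (Y x) * kaehlerForm I J x (X x) (Z x)
        + η x (Z x) * kaehlerForm I J x (X x) (Y x)

/-- The vector field `B₁ = η^♯`, i.e. `g(v, B₁) = η(v)`. For a Lee form `η` this is the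
Lee vector field. -/
noncomputable def leeField (η : Π x : M, TangentSpace I x →L[ℝ] ℝ) (x : M) : TangentSpace I x :=
  (InnerProductSpace.toDual ℝ (TangentSpace I x)).symm (η x)

/-- A Riemannian submersion is Lagrangian if `J (ker f_*) = (ker f_*)^⊥`. -/
structure IsLagrangianSubmersion
    {E' : Type*} [NormedAddCommGroup E'] [NormedSpace ℝ E']
    {H' : Type*} [TopologicalSpace H'] (I' : ModelWithCorners ℝ E' H')
    {B : Type*} [TopologicalSpace B] [ChartedSpace H' B] [IsManifold I' ∞ B]
    [RiemannianBundle (fun y : B ↦ TangentSpace I' y)]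
    (J : Π x : M, TangentSpace I x →L[ℝ] TangentSpace I x) (f : M → B) : Prop
    extends IsRiemannianSubmersion I I' f where
  map_verticalSpace : ∀ x,
    (verticalSpace I I' f x).map (J x).toLinearMap = horizontalSpace I I' f x

end LCK

section HermitianConnection

set_option linter.unusedSectionVars false

variable {E : Type*} [NormedAddCommGroup E] [NormedSpace ℝ E] [FiniteDimensional ℝ E]
  {H : Type*} [TopologicalSpace H] {I : ModelWithCorners ℝ E H}
  {M : Type*} [TopologicalSpace M] [ChartedSpace H M] [IsManifold I ∞ M]
  [RiemannianBundle (fun x : M ↦ TangentSpace I x)]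
  [IsContMDiffRiemannianBundle I ∞ E (fun x : M ↦ TangentSpace I x)]
  {J : Π x : M, TangentSpace I x →L[ℝ] TangentSpace I x}
  {η : Π x : M, TangentSpace I x →L[ℝ] ℝ}
  {x : M} {X Y Z : Π x : M, TangentSpace I x}

namespace IsHermitianStructure

lemma mdiffAt_apply (hJ : IsHermitianStructure I J) (hX : MDiffAt (T% X) x) :
    MDiffAt (T% (fun y ↦ J y (X y))) x :=
  MDifferentiableAt.clm_bundle_apply (F₁ := E) (F₂ := E) (b := fun y : M ↦ y)
    ((hJ.contMDiff x).mdifferentiableAt (by simp)) hX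

lemma inner_map_left (hJ : IsHermitianStructure I J) (v w : TangentSpace I x) :
    inner ℝ (J x v) w = -inner ℝ v (J x w) := by
  have h := hJ.inner_map_map x v (J x w)
  rw [hJ.sq, inner_neg_right] at h
  linarith

/-- On a Hermitian manifold,
`2 g(∇_X (JY) - J (∇_X Y), Z) = dΩ(X, JY, JZ) - dΩ(X, Y, Z)`. -/
theorem two_mul_inner_leviCivita_sub (hJ : IsHermitianStructure I J) (hX : MDiffAt (T% X) x)
    (hY : MDiffAt (T% Y) x) (hZ : MDiffAt (T% Z) x) :
    2 * inner ℝ (leviCivita I M (fun y ↦ J y (Y y)) x (X x) - J x (leviCivita I M Y x (X x)))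
        (Z x) =
      extDerivTwoForm I (kaehlerForm I J) X (fun y ↦ J y (Y y)) (fun y ↦ J y (Z y)) x
        - extDerivTwoForm I (kaehlerForm I J) X Y Z x := by
  have hJY := hJ.mdiffAt_apply hY
  have hJZ := hJ.mdiffAt_apply hZ
  have hN : inner ℝ (nijenhuis I J Y Z x) (J x (X x)) = 0 := by
    rw [hJ.nijenhuis_eq_zero x Y Z hY hZ, inner_zero_left]
  have h₁ := inner_leviCivitaFun hX hJY hZ
  have h₂ := inner_leviCivitaFun hX hY hJZ
  change 2 * inner ℝ (leviCivitaFun I (fun y ↦ J y (Y y)) x (X x)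
    - J x (leviCivitaFun I Y x (X x))) (Z x) = _
  rw [inner_sub_left, hJ.inner_map_left, h₁, h₂]
  have hneg : ∀ g : M → ℝ, mvfderiv I (fun y ↦ -g y) x = -mvfderiv I g x :=
    fun _ ↦ mvfderiv_neg
  simp only [nijenhuis, inner_sub_left, hJ.inner_map_left, hJ.sq, inner_neg_right] at hN
  simp only [koszulForm, extDerivTwoForm, kaehlerForm, hJ.inner_map_left, hJ.sq, inner_neg_right,
    map_neg, hneg, neg_apply]
  linarith

/-- The covariant derivative of the complex structure of a locally conformal Kähler manifold. -/
theorem two_mul_inner_leviCivita_sub_of_isLeeForm (hJ : IsHermitianStructure I J)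
    (hη : IsLeeForm I J η) (hX : MDiffAt (T% X) x) (hY : MDiffAt (T% Y) x)
    (z : TangentSpace I x) :
    2 * inner ℝ (leviCivita I M (fun y ↦ J y (Y y)) x (X x) - J x (leviCivita I M Y x (X x))) z =
      η x (J x (Y x)) * inner ℝ (X x) z - η x (J x z) * inner ℝ (X x) (Y x)
        + η x (Y x) * inner ℝ (X x) (J x z) - η x z * inner ℝ (X x) (J x (Y x)) := by
  have hZ := FiberBundle.mdifferentiableAt_extend I E z
  have h := hJ.two_mul_inner_leviCivita_sub hX hY hZ
  rw [hη.extDeriv_kaehlerForm x _ _ _ hX (hJ.mdiffAt_apply hY) (hJ.mdiffAt_apply hZ),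
    hη.extDeriv_kaehlerForm x _ _ _ hX hY hZ] at h
  simp only [FiberBundle.extend_apply_self, kaehlerForm, hJ.sq, map_neg, inner_neg_right,
    hJ.inner_map_left] at h
  rw [h]
  ring

/-- If `X` and `Y` are `g`-orthogonal to the Lee field and span an isotropic plane for the Kähler
form at `x`, then `∇_X (JY) - ∇_Y (JX) = J [X, Y] + (η(JY) X - η(JX) Y) / 2` there. -/
theorem leviCivita_map_sub_leviCivita_map (hJ : IsHermitianStructure I J)
    (hη : IsLeeForm I J η) (hX : MDiffAt (T% X) x) (hY : MDiffAt (T% Y) x)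
    (hηX : η x (X x) = 0) (hηY : η x (Y x) = 0) (hXY : inner ℝ (X x) (J x (Y x)) = 0) :
    leviCivita I M (fun y ↦ J y (Y y)) x (X x) - leviCivita I M (fun y ↦ J y (X y)) x (Y x) =
      J x (mlieBracket I X Y x)
        + ((2⁻¹ * η x (J x (Y x))) • X x - (2⁻¹ * η x (J x (X x))) • Y x) := by
  have htor : mlieBracket I X Y x = leviCivita I M Y x (X x) - leviCivita I M X x (Y x) :=
    (((leviCivita I M).torsion_eq_zero_iff.1 leviCivita_torsion) hX hY).symm
  have hYX : inner ℝ (Y x) (J x (X x)) = 0 := by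
    have h := hJ.inner_map_left (Y x) (X x)
    rw [real_inner_comm, hXY] at h
    linarith
  refine ext_inner_right ℝ fun z ↦ ?_
  have h₁ := hJ.two_mul_inner_leviCivita_sub_of_isLeeForm hη hX hY z
  have h₂ := hJ.two_mul_inner_leviCivita_sub_of_isLeeForm hη hY hX z
  simp only [hηX, hηY, hXY, hYX, inner_sub_left] at h₁ h₂
  simp only [htor, map_sub, inner_sub_left, inner_add_left, inner_smul_left,
    RCLike.conj_to_real]
  rw [real_inner_comm (Y x) (X x)] at h₁
  linarith

end IsHermitianStructure

lemma inner_leeField (η : Π x : M, TangentSpace I x →L[ℝ] ℝ) (v : TangentSpace I x) :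
    inner ℝ v (leeField I η x) = η x v := by
  rw [real_inner_comm, leeField, InnerProductSpace.toDual_symm_apply]

lemma leviCivita_zero_section : leviCivita I M (0 : Π x : M, TangentSpace I x) x = 0 :=
  congrFun (leviCivita I M).zero x

end HermitianConnection

section LagrangianSubmersion

set_option linter.unusedSectionVars false

variable {E : Type*} [NormedAddCommGroup E] [NormedSpace ℝ E] [FiniteDimensional ℝ E]
  {H : Type*} [TopologicalSpace H] {I : ModelWithCorners ℝ E H}
  {M : Type*} [TopologicalSpace M] [ChartedSpace H M] [IsManifold I ∞ M]
  [RiemannianBundle (fun x : M ↦ TangentSpace I x)]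
  [IsContMDiffRiemannianBundle I ∞ E (fun x : M ↦ TangentSpace I x)]
  {E' : Type*} [NormedAddCommGroup E'] [NormedSpace ℝ E'] [FiniteDimensional ℝ E']
  {H' : Type*} [TopologicalSpace H'] {I' : ModelWithCorners ℝ E' H'}
  {B : Type*} [TopologicalSpace B] [ChartedSpace H' B] [IsManifold I' ∞ B]
  [RiemannianBundle (fun y : B ↦ TangentSpace I' y)]
  [IsContMDiffRiemannianBundle I' ∞ E' (fun y : B ↦ TangentSpace I' y)]
  {J : Π x : M, TangentSpace I x →L[ℝ] TangentSpace I x}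
  {f : M → B} {x : M} {X Y U : Π x : M, TangentSpace I x}

lemma mem_verticalSpace {v : TangentSpace I x} :
    v ∈ verticalSpace I I' f x ↔ mfderiv I I' f x v = 0 :=
  Iff.rfl

lemma vert_of_mem {v : TangentSpace I x} (hv : v ∈ verticalSpace I I' f x) :
    vert I I' f x v = v :=
  Submodule.starProjection_eq_self_iff.2 hv

lemma horiz_of_mem {v : TangentSpace I x} (hv : v ∈ horizontalSpace I I' f x) :
    horiz I I' f x v = v :=
  Submodule.starProjection_eq_self_iff.2 hv

lemma horiz_of_mem_verticalSpace {v : TangentSpace I x} (hv : v ∈ verticalSpace I I' f x) :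
    horiz I I' f x v = 0 :=
  (Submodule.starProjection_apply_eq_zero_iff _).2
    (Submodule.le_orthogonal_orthogonal _ hv)

lemma mfderiv_horiz (v : TangentSpace I x) :
    mfderiv I I' f x (horiz I I' f x v) = mfderiv I I' f x v := by
  have h : v - horiz I I' f x v ∈ verticalSpace I I' f x := by
    have := Submodule.sub_starProjection_mem_orthogonal (K := horizontalSpace I I' f x) v
    rwa [horizontalSpace, Submodule.orthogonal_orthogonal] at this
  rw [mem_verticalSpace, map_sub, sub_eq_zero] at h
  exact h.symm

lemma IsHorizontalField.mdiffAt (hX : IsHorizontalField I I' f X) (x : M) : MDiffAt (T% X) x :=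
  (hX.contMDiff x).mdifferentiableAt (by simp)

lemma IsLagrangianSubmersion.map_mem_verticalSpace_iff (hf : IsLagrangianSubmersion I I' J f)
    (hJ : IsHermitianStructure I J) {v : TangentSpace I x} :
    J x v ∈ verticalSpace I I' f x ↔ v ∈ horizontalSpace I I' f x := by
  rw [← hf.map_verticalSpace x, Submodule.mem_map]
  refine ⟨fun h ↦ ⟨-J x v, neg_mem h, ?_⟩, ?_⟩
  · change J x (-J x v) = v
    rw [map_neg, hJ.sq, neg_neg]
  · rintro ⟨u, hu, rfl⟩
    change J x (J x u) ∈ _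
    rw [hJ.sq]
    exact neg_mem hu

/-- The zero section is parallel for a pullback connection. -/
lemma pullbackConnection_zero (cov : CovariantDerivative I' E' (TangentSpace I' : B → Type _)) :
    pullbackConnection I cov f (fun y ↦ (0 : TangentSpace I' (f y))) x = 0 := by
  have h₀ : ∀ y : B, (trivializationAt E' (TangentSpace I' : B → Type _) (f x)
      ⟨y, (0 : TangentSpace I' y)⟩).2 = 0 := fun y ↦ by
    rw [TangentBundle.trivializationAt_apply]
    exact map_zero _
  have h₁ : (fun y ↦ (trivializationAt E' (TangentSpace I' : B → Type _) (f x)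
      ⟨f y, (0 : TangentSpace I' (f y))⟩).2) = fun _ : M ↦ (0 : E') := funext fun y ↦ h₀ (f y)
  have h₂ : cov (FiberBundle.extend E' (0 : TangentSpace I' (f x))) (f x) = 0 := by
    rw [cov.isCovariantDerivativeOnUniv.congr_of_eventuallyEq
      (FiberBundle.mdifferentiableAt_extend I' E' (0 : TangentSpace I' (f x)))
      (mdifferentiableAt_zeroSection ..) Filter.univ_mem ?_]
    · exact congrFun cov.zero (f x)
    · let e := trivializationAt E' (TangentSpace I' : B → Type _) (f x)
      filter_upwards [e.open_baseSet.mem_nhds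
        (FiberBundle.mem_baseSet_trivializationAt' (f x))] with y hy
      rw [FiberBundle.extend, h₀, ← Bundle.Trivialization.coe_symmₗ (R := ℝ) _ hy, map_zero]
  rw [pullbackConnection, h₁, h₂, mvfderiv_const]
  simp

lemma secondFundamentalForm_of_vertical (hU : ∀ y, U y ∈ verticalSpace I I' f y) :
    secondFundamentalForm I I' f X U x = -mfderiv I I' f x (leviCivita I M U x (X x)) := by
  have h : (fun y ↦ mfderiv I I' f y (U y)) = fun y ↦ (0 : TangentSpace I' (f y)) :=
    funext fun y ↦ mem_verticalSpace.1 (hU y)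
  rw [secondFundamentalForm, h, pullbackConnection_zero, zero_apply, zero_sub]

lemma mfderiv_oneillA_of_vertical (hX : X x ∈ horizontalSpace I I' f x)
    (hU : ∀ y, U y ∈ verticalSpace I I' f y) :
    mfderiv I I' f x (oneillA I I' f X U x) =
      mfderiv I I' f x (leviCivita I M U x (X x)) := by
  have h₁ : (fun y ↦ vert I I' f y (U y)) = U := funext fun y ↦ vert_of_mem (hU y)
  have h₂ : (fun y ↦ horiz I I' f y (U y)) = 0 :=
    funext fun y ↦ horiz_of_mem_verticalSpace (hU y)
  have h₃ : vert I I' f x 0 = 0 := vert_of_mem (zero_mem _)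
  rw [oneillA, h₁, h₂, leviCivita_zero_section, zero_apply, h₃, add_zero, mfderiv_horiz,
    horiz_of_mem hX]

/-- For a Lagrangian submersion of a locally conformal Kähler manifold with vertical Lee field,
and horizontal `X`, `Y`,
`f_*(∇_X (JY) - ∇_Y (JX)) = f_*(J [X, Y]) + (g(JY, B₁) f_* X - g(JX, B₁) f_* Y) / 2`. -/
theorem IsLagrangianSubmersion.mfderiv_leviCivita_sub {η : Π x : M, TangentSpace I x →L[ℝ] ℝ}
    (hf : IsLagrangianSubmersion I I' J f) (hJ : IsHermitianStructure I J)
    (hη : IsLeeForm I J η) (hB₁ : ∀ x, leeField I η x ∈ verticalSpace I I' f x)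
    (hX : IsHorizontalField I I' f X) (hY : IsHorizontalField I I' f Y) (x : M) :
    mfderiv I I' f x (leviCivita I M (fun y ↦ J y (Y y)) x (X x))
        - mfderiv I I' f x (leviCivita I M (fun y ↦ J y (X y)) x (Y x)) =
      mfderiv I I' f x (J x (mlieBracket I X Y x))
        + ((2⁻¹ * inner ℝ (vert I I' f x (J x (Y x))) (leeField I η x) : ℝ) •
              mfderiv I I' f x (X x)
            - (2⁻¹ * inner ℝ (vert I I' f x (J x (X x))) (leeField I η x) : ℝ) •
              mfderiv I I' f x (Y x)) := by
  have hJX := (hf.map_mem_verticalSpace_iff hJ).2 (hX.horizontal x)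
  have hJY := (hf.map_mem_verticalSpace_iff hJ).2 (hY.horizontal x)
  rw [vert_of_mem hJX, vert_of_mem hJY, inner_leeField, inner_leeField, ← map_sub,
    hJ.leviCivita_map_sub_leviCivita_map hη (hX.mdiffAt x) (hY.mdiffAt x), map_add, map_sub,
    map_smul, map_smul]
  · rw [← inner_leeField]
    exact Submodule.inner_left_of_mem_orthogonal (hB₁ x) (hX.horizontal x)
  · rw [← inner_leeField]
    exact Submodule.inner_left_of_mem_orthogonal (hB₁ x) (hY.horizontal x)
  · exact Submodule.inner_left_of_mem_orthogonal hJY (hX.horizontal x)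

end LagrangianSubmersion

theorem corollary3p5
    {E : Type*} [NormedAddCommGroup E] [NormedSpace ℝ E] [FiniteDimensional ℝ E]
    {H : Type*} [TopologicalSpace H] (I : ModelWithCorners ℝ E H)
    {M : Type*} [TopologicalSpace M] [ChartedSpace H M] [IsManifold I ∞ M]
    [BoundarylessManifold I M]
    [RiemannianBundle (fun x : M ↦ TangentSpace I x)]
    [IsContMDiffRiemannianBundle I ∞ E (fun x : M ↦ TangentSpace I x)]
    {E' : Type*} [NormedAddCommGroup E'] [NormedSpace ℝ E'] [FiniteDimensional ℝ E']
    {H' : Type*} [TopologicalSpace H'] (I' : ModelWithCorners ℝ E' H')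
    {B : Type*} [TopologicalSpace B] [ChartedSpace H' B] [IsManifold I' ∞ B]
    [BoundarylessManifold I' B]
    [RiemannianBundle (fun y : B ↦ TangentSpace I' y)]
    [IsContMDiffRiemannianBundle I' ∞ E' (fun y : B ↦ TangentSpace I' y)]
    (J : Π x : M, TangentSpace I x →L[ℝ] TangentSpace I x) (hJ : IsHermitianStructure I J)
    (η : Π x : M, TangentSpace I x →L[ℝ] ℝ) (hη : IsLeeForm I J η)
    (f : M → B) (hf : IsLagrangianSubmersion I I' J f)
    (hB₁ : ∀ x, leeField I η x ∈ verticalSpace I I' f x) :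
    List.TFAE
      [IsHorizontalIntegrable I I' f,
       ∀ X Y : Π x : M, TangentSpace I x, IsHorizontalField I I' f X → IsHorizontalField I I' f Y →
         ∀ x, secondFundamentalForm I I' f X (fun y ↦ J y (Y y)) x =
           secondFundamentalForm I I' f Y (fun y ↦ J y (X y)) x
             - (2⁻¹ * inner ℝ (vert I I' f x (J x (Y x))) (leeField I η x) : ℝ) •
                 mfderiv I I' f x (X x)
             + (2⁻¹ * inner ℝ (vert I I' f x (J x (X x))) (leeField I η x) : ℝ) •
                 mfderiv I I' f x (Y x),
       ∀ X Y : Π x : M, TangentSpace I x, IsHorizontalField I I' f X → IsHorizontalField I I' f Y →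
         ∀ x, mfderiv I I' f x
             (oneillA I I' f X (fun y ↦ J y (Y y)) x - oneillA I I' f Y (fun y ↦ J y (X y)) x) =
           (2⁻¹ * inner ℝ (vert I I' f x (J x (Y x))) (leeField I η x) : ℝ) •
               mfderiv I I' f x (X x)
             - (2⁻¹ * inner ℝ (vert I I' f x (J x (X x))) (leeField I η x) : ℝ) •
                 mfderiv I I' f x (Y x)] := by
  have hJvert : ∀ {X : Π x : M, TangentSpace I x}, IsHorizontalField I I' f X →
      ∀ y, J y (X y) ∈ verticalSpace I I' f y :=
    fun hX y ↦ (hf.map_mem_verticalSpace_iff hJ).2 (hX.horizontal y)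
  have key := fun X Y hX hY ↦ hf.mfderiv_leviCivita_sub (X := X) (Y := Y) hJ hη hB₁ hX hY
  have hbracket : ∀ (X Y : Π x : M, TangentSpace I x) (x : M),
      mlieBracket I X Y x ∈ horizontalSpace I I' f x ↔
        mfderiv I I' f x (J x (mlieBracket I X Y x)) = 0 :=
    fun X Y x ↦ (hf.map_mem_verticalSpace_iff hJ).symm
  tfae_have 1 ↔ 3 := by
    refine forall₄_congr fun X Y hX hY ↦ forall_congr' fun x ↦ ?_
    rw [hbracket, map_sub, mfderiv_oneillA_of_vertical (hX.horizontal x) (hJvert hY),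
      mfderiv_oneillA_of_vertical (hY.horizontal x) (hJvert hX), key X Y hX hY x, add_eq_right]
  tfae_have 2 ↔ 3 := by
    refine forall₄_congr fun X Y hX hY ↦ forall_congr' fun x ↦ ?_
    rw [map_sub, mfderiv_oneillA_of_vertical (hX.horizontal x) (hJvert hY),
      mfderiv_oneillA_of_vertical (hY.horizontal x) (hJvert hX),
      secondFundamentalForm_of_vertical (hJvert hY),
      secondFundamentalForm_of_vertical (hJvert hX)]
    constructor <;> intro h
    · rw [neg_eq_iff_eq_neg.1 h]
      abel
    · rw [sub_eq_iff_eq_add.1 h]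
      abel
  tfae_finish
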